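/- Let $\mathcal H=\bigoplus_{n\in\mathbb N}\mathcal H_n$ be a countably infinite orthogonal Hilbert sum of complex Hilbert spaces (no separability is assumed). For each $n$ let $S_n$ be a densely defined symmetric operator in $\mathcal H_n$. An interval $J=(a,b)$ that is finite or semi-infinite is called a gap of a symmetric operator $T$ if, for all $f$ in the domain $\mathcal D(T)$, one has $\|(T-\tfrac{a+b}{2})f\|\ge\tfrac{b-a}{2}\|f\|$ when $a,b$ are finite; $\langle f,Tf\rangle\ge b\|f\|^2$ when $a=-\infty$ and $b$ is finite; $\langle f,Tf\rangle\le a\|f\|^2$ when $a$ is finite and $b=+\infty$. The operator $T$ has deficiency index $d\in\{0,1,2,\dots\}\cup\{\infty\}$ if $\dim\ker(T^*-z)=d$ for all $z\in\mathbb C\setminus\mathbb R$. Assume that each $S_n$ has deficiency index $1$ and a gap $J_n$, and that $(a,b)$, with $-\infty\le a<b\le+\infty$, is a nonempty open interval contained in all the $J_n$. Let $S=\bigoplus_n S_n$ be the orthogonal sum, that is, $\mathcal D(S)=\{(x_n)_n\in\mathcal H:\ x_n\in\mathcal D(S_n)\ \forall n,\ \sum_n\|S_nx_n\|^2<\infty\}$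 and $S(x_n)_n=(S_nx_n)_n$. Then: (i) $S$ is densely defined and symmetric, $(a,b)$ is a gap of $S$, the deficiency index of $S$ is infinite, $\dim\ker(S^*-t)=\infty$ also for every $t\in(a,b)$, and $S$ admits self-adjoint extensions in $\mathcal H$. (ii) For every finite or countably infinite family $(\lambda_k)_k$ of (possibly repeated) points of $(a,b)$ there is a self-adjoint extension of $S$ in $\mathcal H$ that has every $\lambda_k$ as an eigenvalue, and such that, for each value $\lambda$ of the family, the multiplicity of $\lambda$ (the Hilbert space dimension of its eigenspace) equals the number of indices $k$ with $\lambda_k=\lambda$. (iii) For every closed set $K\subset\mathbb R$ contained in the closure of $(a,b)$ in $\mathbb R$ there is a self-adjoint extension of $S$ in $\mathcal H$ whose essential spectrum (the spectrum without the isolated points that are eigenvalues of finite multiplicity) contains $K$. -/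

import Mathlib

open Filter Topology
open scoped ENNReal

noncomputable section

namespace LinearPMap

section Single

variable {H : Type*} [NormedAddCommGroup H] [InnerProductSpace ℂ H]

/-- The open interval `(a, b)` of real numbers with possibly infinite endpoints. -/
def openInterval (a b : EReal) : Set ℝ := {x : ℝ | a < (x : EReal) ∧ (x : EReal) < b}

/-- `(a, b)` is a gap of the symmetric operator `S`. The interval is finite or semi-infinite:
* `a = -∞`, `b` finite: `⟨f, S f⟩ ≥ b ‖f‖²` on the domain of `S`;
* `a`, `b` finite: `‖(S - (a + b) / 2) f‖ ≥ ((b - a) / 2) ‖f‖` on the domain of `S`;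
* `a` finite, `b = +∞`: `⟨f, S f⟩ ≤ a ‖f‖²` on the domain of `S`.
The inner product `⟨f, S f⟩` is real when `S` is symmetric. -/
def HasGap (S : H →ₗ.[ℂ] H) (a b : EReal) : Prop :=
  (∃ β : ℝ, a = ⊥ ∧ b = (β : EReal) ∧
    ∀ f : S.domain, β * ‖(f : H)‖ ^ 2 ≤ (inner ℂ (f : H) (S f)).re) ∨
  (∃ α β : ℝ, a = (α : EReal) ∧ b = (β : EReal) ∧ α < β ∧
    ∀ f : S.domain,
      (β - α) / 2 * ‖(f : H)‖ ≤ ‖S f - (((α + β) / 2 : ℝ) : ℂ) • (f : H)‖) ∨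
  (∃ α : ℝ, a = (α : EReal) ∧ b = ⊤ ∧
    ∀ f : S.domain, (inner ℂ (f : H) (S f)).re ≤ α * ‖(f : H)‖ ^ 2)

/-- `ker (A - z)`: the vectors `x` in the domain of `A` with `A x = z x`. -/
def eigenspace (A : H →ₗ.[ℂ] H) (z : ℂ) : Submodule ℂ H :=
  (LinearMap.ker (A.toFun - z • A.domain.subtype)).map A.domain.subtype

/-- `z` is an eigenvalue of `A`. -/
def HasEigenvalue (A : H →ₗ.[ℂ] H) (z : ℂ) : Prop := A.eigenspace z ≠ ⊥

/-- The multiplicity of `z` as an eigenvalue of `A`, that is, the Hilbert space dimension of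
`ker (A - z)`, equals the cardinality of `ι`. -/
def HasMultiplicity (A : H →ₗ.[ℂ] H) (z : ℂ) (ι : Type*) : Prop :=
  Nonempty (HilbertBasis ι ℂ (A.eigenspace z))

/-- The resolvent set of `A`: the `z` for which `A - z` is a bijection from the domain of `A`
onto the whole space with bounded inverse. -/
def resolventSet (A : H →ₗ.[ℂ] H) : Set ℂ :=
  {z | ∃ B : H →L[ℂ] H,
    (∀ y : H, ∃ h : B y ∈ A.domain, A ⟨B y, h⟩ - z • B y = y) ∧
    ∀ x : A.domain, B (A x - z • (x : H)) = x}

/-- The spectrum of `A`. -/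
def spectrum (A : H →ₗ.[ℂ] H) : Set ℂ := (A.resolventSet)ᶜ

/-- The discrete spectrum of a self-adjoint operator: the eigenvalues of finite multiplicity that
are isolated points of the spectrum. -/
def discreteSpectrum (A : H →ₗ.[ℂ] H) : Set ℂ :=
  {z | z ∈ A.spectrum ∧ (∀ᶠ w in 𝓝[≠] z, w ∉ A.spectrum) ∧
    A.HasEigenvalue z ∧ FiniteDimensional ℂ (A.eigenspace z)}

/-- The essential spectrum of a self-adjoint operator: the complement in the spectrum of the
discrete spectrum. -/
def essentialSpectrum (A : H →ₗ.[ℂ] H) : Set ℂ := A.spectrum \ A.discreteSpectrum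

variable [CompleteSpace H]

/-- The dimension of the deficiency space `ker (S* - z)`, a natural number or `∞`. -/
def deficiency (S : H →ₗ.[ℂ] H) (z : ℂ) : ℕ∞ :=
  Cardinal.toENat (Module.rank ℂ (S.adjoint.eigenspace z))

/-- `S` has deficiency index `d`: `dim ker (S* - z) = d` for all non-real `z`. -/
def HasDeficiencyIndex (S : H →ₗ.[ℂ] H) (d : ℕ∞) : Prop :=
  ∀ z : ℂ, z.im ≠ 0 → S.deficiency z = d

/-- `A` is a self-adjoint extension of `S`. -/
def IsSelfAdjointExtension (S A : H →ₗ.[ℂ] H) : Prop := S ≤ A ∧ IsSelfAdjoint A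

end Single

section Sum

variable {ι : Type*} {H : ι → Type*} [∀ n, NormedAddCommGroup (H n)]
  [∀ n, InnerProductSpace ℂ (H n)]

/-- The orthogonal sum `⨁ S n` in the Hilbert sum of the spaces `H n`: its domain consists of the
`x` with `x n` in the domain of `S n` for all `n` and `∑ ‖S n (x n)‖² < ∞`, and it acts
componentwise. -/
def orthogonalSum (S : ∀ n, H n →ₗ.[ℂ] H n) : lp H 2 →ₗ.[ℂ] lp H 2 where
  domain :=
    { carrier := {x | ∃ h : ∀ n, x n ∈ (S n).domain, Memℓp (fun n => S n ⟨x n, h n⟩) 2}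
      zero_mem' := by
        refine ⟨fun n => (S n).domain.zero_mem, ?_⟩
        have h0 : (fun n => S n ⟨(0 : lp H 2) n, (S n).domain.zero_mem⟩) = 0 := by
          funext n
          exact (S n).map_zero
        rw [h0]
        exact zero_memℓp
      add_mem' := by
        rintro x y ⟨hx, hx2⟩ ⟨hy, hy2⟩
        refine ⟨fun n => (S n).domain.add_mem (hx n) (hy n), ?_⟩
        convert hx2.add hy2 using 1
        funext n
        exact (S n).map_add ⟨x n, hx n⟩ ⟨y n, hy n⟩
      smul_mem' := by
        rintro c x ⟨hx, hx2⟩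
        refine ⟨fun n => (S n).domain.smul_mem c (hx n), ?_⟩
        convert hx2.const_smul c using 1
        funext n
        exact (S n).map_smul c ⟨x n, hx n⟩ }
  toFun :=
    { toFun := fun x => ⟨fun n => S n ⟨(x : lp H 2) n, x.2.choose n⟩, x.2.choose_spec⟩
      map_add' := fun x y => by
        ext n
        exact (S n).map_add ⟨(x : lp H 2) n, x.2.choose n⟩ ⟨(y : lp H 2) n, y.2.choose n⟩
      map_smul' := fun c x => by
        ext n
        exact (S n).map_smul c ⟨(x : lp H 2) n, x.2.choose n⟩ }

end Sum

end LinearPMap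

end

namespace LinearPMap

open scoped ComplexConjugate

section Single

variable {H : Type*} [NormedAddCommGroup H] [InnerProductSpace ℂ H]

/-! Fix a real `t` in the gap. The lower bound on `S n - t` makes the deficiency stable across the
real axis, so `ker (S n* - t)` is one-dimensional (`rank_adjoint_eigenspace_le`,
`HasDeficiencyIndex.deficiency_ofReal`). Restricting `S n*` to those `x` with `(S n* - t) x ⟂ ker (S
n* - t)` gives a self-adjoint extension `extensionAt`, with domain `D(closure of S n) + ker (S n* -
t)`. It has `t` as a simple eigenvalue, and the gap estimate excludes every other eigenvalue in the
gap (`eigenspace_extensionAt_eq_bot`).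

Orthogonal sums commute with adjoints (`adjoint_orthogonalSum`), so sums of such extensions are
self-adjoint and their eigenspaces are computed componentwise. Giving each `lam k` its own summand,
and all remaining summands one point of the gap outside the family, realises exactly the prescribed
multiplicities. With the rationals of the gap as the family, eigenvalues accumulate at every point
of the closed gap; such points are essential spectrum, so one extension serves every `K`. -/

theorem mem_eigenspace_iff {A : H →ₗ.[ℂ] H} {z : ℂ} {x : H} :
    x ∈ A.eigenspace z ↔ ∃ h : x ∈ A.domain, A ⟨x, h⟩ = z • x := by
  simp only [eigenspace, Submodule.mem_map, LinearMap.mem_ker]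
  constructor
  · rintro ⟨⟨y, hy⟩, h, rfl⟩
    exact ⟨hy, sub_eq_zero.1 h⟩
  · rintro ⟨h, hx⟩
    exact ⟨⟨x, h⟩, sub_eq_zero.2 hx, rfl⟩

/-! ### Spectrum -/

theorem HasEigenvalue.mem_spectrum {A : H →ₗ.[ℂ] H} {z : ℂ} (h : A.HasEigenvalue z) :
    z ∈ A.spectrum := by
  rintro ⟨B, -, hB⟩
  obtain ⟨x, hx, hx0⟩ := Submodule.exists_mem_ne_zero_of_ne_bot h
  obtain ⟨hd, hA⟩ := mem_eigenspace_iff.1 hx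
  have := hB ⟨x, hd⟩
  rw [hA, sub_self, _root_.map_zero] at this
  exact hx0 this.symm

/-- An accumulation point of eigenvalues belongs to the essential spectrum. -/
theorem mem_essentialSpectrum_of_frequently {A : H →ₗ.[ℂ] H} {z : ℂ}
    (h : ∃ᶠ w in 𝓝[≠] z, A.HasEigenvalue w) : z ∈ A.essentialSpectrum := by
  refine ⟨?_, fun hd => h (hd.2.1.mono fun w hw h' => hw h'.mem_spectrum)⟩
  rintro ⟨B, -, hB⟩
  -- If `B` inverts `A - z`, an eigenvector `x` at `w` satisfies `x = (w - z) • B x`, which is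
  -- impossible once `‖B‖ * ‖w - z‖ < 1`.
  refine h (Filter.Eventually.filter_mono nhdsWithin_le_nhds ?_)
  have hlim : Tendsto (fun w : ℂ => ‖B‖ * ‖w - z‖) (𝓝 z) (𝓝 0) := by
    have : Continuous fun w : ℂ => ‖B‖ * ‖w - z‖ := by fun_prop
    simpa using this.tendsto z
  filter_upwards [hlim.eventually (gt_mem_nhds one_pos)] with w hw he
  obtain ⟨x, hx, hx0⟩ := Submodule.exists_mem_ne_zero_of_ne_bot he
  obtain ⟨hd, hA⟩ := mem_eigenspace_iff.1 hx
  have h1 := hB ⟨x, hd⟩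
  rw [hA, ← sub_smul] at h1
  have h2 : ‖x‖ ≤ ‖B‖ * ‖w - z‖ * ‖x‖ := by
    calc ‖x‖ = ‖B ((w - z) • x)‖ := by rw [h1]
      _ ≤ ‖B‖ * ‖(w - z) • x‖ := B.le_opNorm _
      _ = _ := by rw [norm_smul, mul_assoc]
  have h3 : 0 < ‖x‖ := norm_pos_iff.2 hx0
  nlinarith

/-! ### Gaps -/

theorem isOpen_openInterval {a b : EReal} : IsOpen (openInterval a b) :=
  (isOpen_lt continuous_const continuous_coe_real_ereal).inter
    (isOpen_lt continuous_coe_real_ereal continuous_const)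

theorem hasGap_bot_coe_iff {S : H →ₗ.[ℂ] H} {β : ℝ} :
    S.HasGap ⊥ β ↔ ∀ f : S.domain, β * ‖(f : H)‖ ^ 2 ≤ (inner ℂ (f : H) (S f)).re := by
  simp [HasGap]

theorem hasGap_coe_coe_iff {S : H →ₗ.[ℂ] H} {α β : ℝ} :
    S.HasGap α β ↔ α < β ∧ ∀ f : S.domain,
      (β - α) / 2 * ‖(f : H)‖ ≤ ‖S f - (((α + β) / 2 : ℝ) : ℂ) • (f : H)‖ := by
  simp only [HasGap, EReal.coe_ne_bot, EReal.coe_ne_top, EReal.coe_eq_coe_iff, false_and, and_false,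
    exists_false, or_false, false_or]
  constructor
  · rintro ⟨_, _, rfl, rfl, h⟩
    exact h
  · exact fun h => ⟨_, _, rfl, rfl, h⟩

theorem hasGap_coe_top_iff {S : H →ₗ.[ℂ] H} {α : ℝ} :
    S.HasGap α ⊤ ↔ ∀ f : S.domain, (inner ℂ (f : H) (S f)).re ≤ α * ‖(f : H)‖ ^ 2 := by
  simp [HasGap]

theorem re_inner_sub_smul (x y : H) (m : ℝ) :
    (inner ℂ x (y - (m : ℂ) • x)).re = (inner ℂ x y).re - m * ‖x‖ ^ 2 := by
  have : inner ℂ x x = ((‖x‖ ^ 2 : ℝ) : ℂ) := by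
    rw [inner_self_eq_norm_sq_to_K]
    norm_cast
  rw [inner_sub_right, inner_smul_right, this, Complex.sub_re, Complex.re_ofReal_mul,
    Complex.ofReal_re]

/-- Cauchy–Schwarz for `x` and `y - m • x`. It turns a semibounded gap into norm estimates on
bounded intervals. -/
theorem mul_norm_le_of_le_re_inner {x y : H} {m β : ℝ}
    (h : β * ‖x‖ ^ 2 ≤ (inner ℂ x y).re) : (β - m) * ‖x‖ ≤ ‖y - (m : ℂ) • x‖ := by
  rcases eq_or_ne x 0 with rfl | hx
  · simp
  have h1 := (Complex.re_le_norm _).trans (norm_inner_le_norm (𝕜 := ℂ) x (y - (m : ℂ) • x))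
  rw [re_inner_sub_smul] at h1
  have h2 : 0 < ‖x‖ := norm_pos_iff.2 hx
  refine le_of_mul_le_mul_left ?_ h2
  nlinarith

theorem mul_norm_le_of_re_inner_le {x y : H} {m α : ℝ}
    (h : (inner ℂ x y).re ≤ α * ‖x‖ ^ 2) : (m - α) * ‖x‖ ≤ ‖y - (m : ℂ) • x‖ := by
  have h1 := mul_norm_le_of_le_re_inner (x := x) (y := -y) (m := -m) (β := -α)
    (by rw [inner_neg_right, Complex.neg_re]; linarith)
  have h2 : -y - ((-m : ℝ) : ℂ) • x = -(y - (m : ℂ) • x) := by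
    push_cast
    module
  rw [h2, norm_neg] at h1
  linarith

theorem mul_norm_le_of_abs_sub_add_le {x y : H} {m m' r r' : ℝ}
    (h : r * ‖x‖ ≤ ‖y - (m : ℂ) • x‖) (hm : |m' - m| + r' ≤ r) :
    r' * ‖x‖ ≤ ‖y - (m' : ℂ) • x‖ := by
  have h1 : ‖y - (m : ℂ) • x‖ ≤ ‖y - (m' : ℂ) • x‖ + |m' - m| * ‖x‖ := by
    have h2 : y - (m : ℂ) • x = (y - (m' : ℂ) • x) + ((m' - m : ℝ) : ℂ) • x := by
      push_cast
      module
    rw [h2]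
    refine (norm_add_le _ _).trans_eq ?_
    rw [norm_smul, Complex.norm_real, Real.norm_eq_abs]
  nlinarith [norm_nonneg x]

theorem HasGap.mono {S : H →ₗ.[ℂ] H} {α β a b : EReal} (h : S.HasGap α β) (hab : a < b)
    (ha : α ≤ a) (hb : b ≤ β) : S.HasGap a b := by
  rcases h with ⟨β, rfl, rfl, h⟩ | ⟨α, β, rfl, rfl, hαβ, h⟩ | ⟨α, rfl, rfl, h⟩
  · induction b with
    | bot => exact absurd hab not_lt_bot
    | top => simp at hb
    | coe b =>
      rw [EReal.coe_le_coe_iff] at hb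
      induction a with
      | bot =>
        refine hasGap_bot_coe_iff.2 fun f => le_trans ?_ (h f)
        gcongr
      | top => simp at hab
      | coe a =>
        rw [EReal.coe_lt_coe_iff] at hab
        refine hasGap_coe_coe_iff.2 ⟨hab, fun f => le_trans ?_ (mul_norm_le_of_le_re_inner (h f))⟩
        gcongr
        linarith
  · induction a with
    | bot => simp at ha
    | top => simp at hab
    | coe a =>
      induction b with
      | bot => simp at hab
      | top => simp at hb
      | coe b =>
        rw [EReal.coe_le_coe_iff] at ha hb
        rw [EReal.coe_lt_coe_iff] at hab
        refine hasGap_coe_coe_iff.2 ⟨hab, fun f => mul_norm_le_of_abs_sub_add_le (h f) ?_⟩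
        rw [← le_sub_iff_add_le, abs_le]
        constructor <;> linarith
  · induction a with
    | top => simp at hab
    | bot => simp at ha
    | coe a =>
      rw [EReal.coe_le_coe_iff] at ha
      induction b with
      | top =>
        refine hasGap_coe_top_iff.2 fun f => (h f).trans ?_
        gcongr
      | bot => simp at hab
      | coe b =>
        rw [EReal.coe_lt_coe_iff] at hab
        refine hasGap_coe_coe_iff.2 ⟨hab, fun f => le_trans ?_ (mul_norm_le_of_re_inner_le (h f))⟩
        gcongr
        linarith

/-- Two points of a gap lie in a bounded gap. -/
theorem HasGap.exists_bound {S : H →ₗ.[ℂ] H} {a b : EReal} (h : S.HasGap a b) {s t : ℝ}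
    (hs : s ∈ openInterval a b) (ht : t ∈ openInterval a b) :
    ∃ m r : ℝ, |s - m| < r ∧ |t - m| < r ∧
      ∀ f : S.domain, r * ‖(f : H)‖ ≤ ‖S f - (m : ℂ) • (f : H)‖ := by
  rcases h with ⟨β, rfl, rfl, h⟩ | ⟨α, β, rfl, rfl, -, h⟩ | ⟨α, rfl, rfl, h⟩
  · have hs' := EReal.coe_lt_coe_iff.1 hs.2
    have ht' := EReal.coe_lt_coe_iff.1 ht.2
    refine ⟨min s t, β - min s t, ?_, ?_, fun f => mul_norm_le_of_le_re_inner (h f)⟩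
    · rw [abs_of_nonneg (sub_nonneg.2 (min_le_left _ _))]; linarith
    · rw [abs_of_nonneg (sub_nonneg.2 (min_le_right _ _))]; linarith
  · have hs1 := EReal.coe_lt_coe_iff.1 hs.1
    have hs2 := EReal.coe_lt_coe_iff.1 hs.2
    have ht1 := EReal.coe_lt_coe_iff.1 ht.1
    have ht2 := EReal.coe_lt_coe_iff.1 ht.2
    refine ⟨(α + β) / 2, (β - α) / 2, abs_lt.2 ?_, abs_lt.2 ?_, h⟩ <;> constructor <;> linarith
  · have hs' := EReal.coe_lt_coe_iff.1 hs.1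
    have ht' := EReal.coe_lt_coe_iff.1 ht.1
    refine ⟨max s t, max s t - α, ?_, ?_, fun f => mul_norm_le_of_re_inner_le (h f)⟩
    · rw [abs_of_nonpos (sub_nonpos.2 (le_max_left _ _))]; linarith
    · rw [abs_of_nonpos (sub_nonpos.2 (le_max_right _ _))]; linarith

/-- Every point of a gap is a point of regular type. -/
theorem HasGap.exists_pos_bound {S : H →ₗ.[ℂ] H} {a b : EReal} (h : S.HasGap a b) {t : ℝ}
    (ht : t ∈ openInterval a b) :
    ∃ c > 0, ∀ f : S.domain, c * ‖(f : H)‖ ≤ ‖S f - (t : ℂ) • (f : H)‖ := by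
  obtain ⟨m, r, -, hr, hf⟩ := h.exists_bound ht ht
  exact ⟨r - |t - m|, sub_pos.2 hr, fun f => mul_norm_le_of_abs_sub_add_le (hf f) (by linarith)⟩

/-! ### Deficiency spaces -/

/-- By symmetry `⟨(S - t) f, f⟩` is real, so the cross term vanishes and an imaginary shift only
adds `ε² ‖f‖²`. A lower bound at `t` thus persists at `t + iε`. -/
theorem norm_sub_smul_le_of_isFormalAdjoint {S : H →ₗ.[ℂ] H} (hsymm : S.IsFormalAdjoint S)
    (t ε : ℝ) (f : S.domain) :
    ‖S f - (t : ℂ) • (f : H)‖ ≤ ‖S f - (t + ε * Complex.I) • (f : H)‖ := by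
  set y := S f - (t : ℂ) • (f : H) with hy
  have h1 : S f - (t + ε * Complex.I) • (f : H) = y - (ε * Complex.I) • (f : H) := by
    rw [hy]; module
  have h2 : (inner ℂ y (f : H)).im = 0 := by
    rw [← Complex.conj_eq_iff_im, inner_conj_symm, hy, inner_sub_left, inner_sub_right,
      hsymm f f, inner_smul_left, inner_smul_right, Complex.conj_ofReal]
  have h3 : RCLike.re (inner ℂ y ((ε * Complex.I) • (f : H))) = 0 := by
    rw [inner_smul_right]
    simp [h2]
  have h4 := norm_sub_sq (𝕜 := ℂ) y ((ε * Complex.I) • (f : H))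
  rw [h3] at h4
  rw [h1]
  refine le_of_sq_le_sq ?_ (norm_nonneg _)
  nlinarith [sq_nonneg ‖(ε * Complex.I) • (f : H)‖]

/-- The orthogonal projection onto `K`, restricted to `L`, has kernel `L ⊓ Kᗮ`. -/
theorem _root_.Submodule.rank_le_of_inf_orthogonal_eq_bot (K L : Submodule ℂ H)
    [K.HasOrthogonalProjection] (h : L ⊓ Kᗮ = ⊥) : Module.rank ℂ L ≤ Module.rank ℂ K := by
  refine LinearMap.rank_le_of_injective
    ((K.orthogonalProjectionOnto : H →ₗ[ℂ] K).comp L.subtype) ?_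
  rw [← LinearMap.ker_eq_bot, LinearMap.ker_eq_bot']
  rintro ⟨u, hu⟩ h0
  have : u ∈ L ⊓ Kᗮ := ⟨hu, by simpa using h0⟩
  rw [h] at this
  simpa using this

variable [CompleteSpace H]

theorem adjoint_eigenspace_conj {S : H →ₗ.[ℂ] H} (hS : Dense (S.domain : Set H)) (z : ℂ) :
    S.adjoint.eigenspace (conj z) = (LinearMap.range (S.toFun - z • S.domain.subtype))ᗮ := by
  ext x
  have key (y : H) (f : S.domain) :
      inner ℂ y (S f - z • (f : H)) = inner ℂ y (S f) - inner ℂ ((conj z) • y) (f : H) := by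
    rw [inner_sub_right, inner_smul_right, inner_smul_left, Complex.conj_conj]
  rw [mem_eigenspace_iff, Submodule.mem_orthogonal']
  constructor
  · rintro ⟨hx, h⟩ _ ⟨f, rfl⟩
    refine (key x f).trans ?_
    rw [← h, adjoint_isFormalAdjoint hS ⟨x, hx⟩ f, sub_self]
  · intro h
    have h1 (f : S.domain) : inner ℂ ((conj z) • x) (f : H) = inner ℂ x (S f) :=
      (sub_eq_zero.1 ((key x f).symm.trans (h _ ⟨f, rfl⟩))).symm
    exact ⟨mem_adjoint_domain_of_exists x ⟨_, h1⟩, adjoint_apply_eq hS _ h1⟩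

theorem adjoint_eigenspace_ofReal {S : H →ₗ.[ℂ] H} (hS : Dense (S.domain : Set H)) (t : ℝ) :
    S.adjoint.eigenspace t = (LinearMap.range (S.toFun - (t : ℂ) • S.domain.subtype))ᗮ := by
  rw [← adjoint_eigenspace_conj hS, Complex.conj_ofReal]

theorem mem_adjoint_eigenspace_iff {S : H →ₗ.[ℂ] H} (hS : Dense (S.domain : Set H)) {z : ℂ}
    {x : H} : x ∈ S.adjoint.eigenspace z ↔
      ∀ f : S.domain, inner ℂ x (S f - conj z • (f : H)) = 0 := by
  conv_lhs => rw [← Complex.conj_conj z, adjoint_eigenspace_conj hS, Submodule.mem_orthogonal']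
  exact ⟨fun h f => h _ ⟨f, rfl⟩, by rintro h _ ⟨f, rfl⟩; exact h f⟩

theorem isClosed_adjoint_eigenspace {S : H →ₗ.[ℂ] H} (hS : Dense (S.domain : Set H)) (z : ℂ) :
    _root_.IsClosed (S.adjoint.eigenspace z : Set H) := by
  rw [← Complex.conj_conj z, adjoint_eigenspace_conj hS]
  exact Submodule.isClosed_orthogonal _

/-- Let `u ∈ ker (S* - conj w)` be orthogonal to `ker (S* - conj z)`. Then `u` lies in the closure
of the range of `S - z`, where pairing with `u` has norm at most `‖z - w‖ / c * ‖u‖`. Pairing `u`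
with itself forces `u = 0`. -/
theorem rank_adjoint_eigenspace_le {S : H →ₗ.[ℂ] H} (hS : Dense (S.domain : Set H)) {z w : ℂ}
    {c : ℝ} (hc : ∀ f : S.domain, c * ‖(f : H)‖ ≤ ‖S f - z • (f : H)‖) (hzw : ‖z - w‖ < c) :
    Module.rank ℂ (S.adjoint.eigenspace (conj w)) ≤
      Module.rank ℂ (S.adjoint.eigenspace (conj z)) := by
  have : CompleteSpace (S.adjoint.eigenspace (conj z)) :=
    (isClosed_adjoint_eigenspace hS _).completeSpace_coe
  apply Submodule.rank_le_of_inf_orthogonal_eq_bot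
  rw [eq_bot_iff]
  rintro u ⟨hw, hz⟩
  have hw' := (mem_adjoint_eigenspace_iff hS).1 hw
  rw [Complex.conj_conj] at hw'
  rw [adjoint_eigenspace_conj hS, Submodule.orthogonal_orthogonal_eq_closure] at hz
  have hc0 : 0 < c := (norm_nonneg _).trans_lt hzw
  have hcl : _root_.IsClosed {v : H | c * ‖inner ℂ u v‖ ≤ ‖z - w‖ * (‖u‖ * ‖v‖)} :=
    _root_.isClosed_le (by fun_prop) (by fun_prop)
  have hu : c * ‖inner ℂ u u‖ ≤ ‖z - w‖ * (‖u‖ * ‖u‖) := by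
    refine closure_minimal ?_ hcl hz
    rintro _ ⟨f, rfl⟩
    change c * ‖inner ℂ u (S f - z • (f : H))‖ ≤ ‖z - w‖ * (‖u‖ * ‖S f - z • (f : H)‖)
    have h1 : S f - z • (f : H) = (S f - w • (f : H)) - (z - w) • (f : H) := by module
    have h2 : ‖inner ℂ u (S f - z • (f : H))‖ = ‖z - w‖ * ‖inner ℂ u (f : H)‖ := by
      rw [h1, inner_sub_right, hw' f, zero_sub, norm_neg, inner_smul_right, norm_mul]
    have h3 := norm_inner_le_norm (𝕜 := ℂ) u (f : H)
    calc c * ‖inner ℂ u (S f - z • (f : H))‖ = ‖z - w‖ * (c * ‖inner ℂ u (f : H)‖) := by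
          rw [h2]; ring
      _ ≤ ‖z - w‖ * (c * (‖u‖ * ‖(f : H)‖)) := by gcongr
      _ = ‖z - w‖ * (‖u‖ * (c * ‖(f : H)‖)) := by ring
      _ ≤ _ := by gcongr; exact hc f
  rw [← inner_self_re_eq_norm, inner_self_eq_norm_mul_norm] at hu
  rw [Submodule.mem_bot, ← norm_eq_zero]
  by_contra h0
  have : 0 < ‖u‖ * ‖u‖ := by positivity
  nlinarith

/-- The deficiency index of a symmetric operator is also the deficiency at real points of regular
type. -/
theorem HasDeficiencyIndex.deficiency_ofReal {S : H →ₗ.[ℂ] H} {d : ℕ∞}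
    (hd : S.HasDeficiencyIndex d) (hS : Dense (S.domain : Set H)) (hsymm : S.IsFormalAdjoint S)
    {t c : ℝ} (hc0 : 0 < c) (hc : ∀ f : S.domain, c * ‖(f : H)‖ ≤ ‖S f - (t : ℂ) • (f : H)‖) :
    S.deficiency t = d := by
  -- The height `c / 2` makes `z` non-real yet closer to `t` than `c`; the lower bound `c` holds at
  -- both points, so the rank comparison works in both directions.
  set z : ℂ := t + (c / 2 : ℝ) * Complex.I with hz
  have hzt : ‖z - t‖ < c := by
    rw [hz, add_sub_cancel_left, norm_mul, Complex.norm_I, mul_one, Complex.norm_real,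
      Real.norm_of_nonneg (by positivity)]
    linarith
  have hz' : z.im = c / 2 := by
    rw [hz, Complex.add_im, Complex.ofReal_im, Complex.im_ofReal_mul, Complex.I_im, zero_add, mul_one]
  have hd' : S.deficiency (conj z) = d := hd _ (by rw [Complex.conj_im, hz']; linarith)
  rw [← hd', ← Complex.conj_ofReal t]
  unfold deficiency
  congr 1
  refine le_antisymm ?_ ?_
  · exact rank_adjoint_eigenspace_le hS
      (fun f => (hc f).trans (norm_sub_smul_le_of_isFormalAdjoint hsymm t (c / 2) f)) hzt
  · exact rank_adjoint_eigenspace_le hS hc (by rwa [norm_sub_rev])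

end Single

/-! ### The self-adjoint extension attached to a real point of regular type -/

section Single

variable {H : Type*} [NormedAddCommGroup H] [InnerProductSpace ℂ H] [CompleteSpace H]

theorem adjoint_le_adjoint {S A : H →ₗ.[ℂ] H} (hS : Dense (S.domain : Set H)) (h : S ≤ A) :
    A.adjoint ≤ S.adjoint := by
  refine IsFormalAdjoint.le_adjoint hS fun f x => ?_
  have hA : Dense (A.domain : Set H) := hS.mono h.1
  rw [h.2 (y := ⟨f, h.1 f.2⟩) rfl]
  exact (adjoint_isFormalAdjoint hA).symm _ x

theorem _root_.IsSelfAdjoint.isClosed_eigenspace {A : H →ₗ.[ℂ] H} (hA : IsSelfAdjoint A) (z : ℂ) :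
    _root_.IsClosed (A.eigenspace z : Set H) := by
  have h := isClosed_adjoint_eigenspace hA.dense_domain z
  rwa [isSelfAdjoint_def.1 hA] at h

/-- The restriction of the adjoint of `S` to the vectors `x` such that `(S* - t) x` is orthogonal
to `ker (S* - t)`. -/
noncomputable def extensionAt (S : H →ₗ.[ℂ] H) (t : ℝ) : H →ₗ.[ℂ] H :=
  S.adjoint.domRestrict
    (((S.adjoint.eigenspace t)ᗮ.comap
      (S.adjoint.toFun - (t : ℂ) • S.adjoint.domain.subtype)).map S.adjoint.domain.subtype)

theorem extensionAt_le_adjoint (S : H →ₗ.[ℂ] H) (t : ℝ) : S.extensionAt t ≤ S.adjoint :=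
  domRestrict_le

theorem mem_extensionAt_domain_iff {S : H →ₗ.[ℂ] H} {t : ℝ} {x : H} :
    x ∈ (S.extensionAt t).domain ↔ ∃ h : x ∈ S.adjoint.domain,
      S.adjoint ⟨x, h⟩ - (t : ℂ) • x ∈ (S.adjoint.eigenspace t)ᗮ := by
  constructor
  · rintro ⟨⟨y, hy, rfl⟩, hx⟩
    exact ⟨hx, hy⟩
  · rintro ⟨h, hx⟩
    exact ⟨⟨⟨x, h⟩, hx, rfl⟩, h⟩

theorem extensionAt_apply_sub_mem {S : H →ₗ.[ℂ] H} {t : ℝ} (x : (S.extensionAt t).domain) :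
    S.extensionAt t x - (t : ℂ) • (x : H) ∈ (S.adjoint.eigenspace t)ᗮ := by
  obtain ⟨h, hx⟩ := mem_extensionAt_domain_iff.1 x.2
  rwa [(extensionAt_le_adjoint S t).2 (y := ⟨x, h⟩) rfl]

theorem le_extensionAt {S : H →ₗ.[ℂ] H} (hS : Dense (S.domain : Set H))
    (hsymm : S.IsFormalAdjoint S) (t : ℝ) : S ≤ S.extensionAt t := by
  have hle := hsymm.le_adjoint hS
  have hdom : S.domain ≤ (S.extensionAt t).domain := by
    intro f hf
    refine mem_extensionAt_domain_iff.2 ⟨hle.1 hf, ?_⟩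
    rw [← hle.2 (x := ⟨f, hf⟩) rfl, Submodule.mem_orthogonal]
    intro u hu
    simpa only [Complex.conj_ofReal] using (mem_adjoint_eigenspace_iff hS).1 hu ⟨f, hf⟩
  refine ⟨hdom, fun f x hfx => ?_⟩
  have hx : (x : H) ∈ S.adjoint.domain := hfx ▸ hle.1 f.2
  rw [(extensionAt_le_adjoint S t).2 (y := ⟨x, hx⟩) rfl]
  exact hle.2 hfx

theorem eigenspace_extensionAt (S : H →ₗ.[ℂ] H) (t : ℝ) :
    (S.extensionAt t).eigenspace t = S.adjoint.eigenspace t := by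
  ext x
  simp only [mem_eigenspace_iff]
  constructor
  · rintro ⟨hx, h⟩
    have hx' := (extensionAt_le_adjoint S t).1 hx
    exact ⟨hx', ((extensionAt_le_adjoint S t).2 (x := ⟨x, hx⟩) (y := ⟨x, hx'⟩) rfl).symm.trans h⟩
  · rintro ⟨hx', h⟩
    have hx : x ∈ (S.extensionAt t).domain := by
      refine mem_extensionAt_domain_iff.2 ⟨hx', ?_⟩
      rw [h, sub_self]
      exact Submodule.zero_mem _
    exact ⟨hx, ((extensionAt_le_adjoint S t).2 (x := ⟨x, hx⟩) (y := ⟨x, hx'⟩) rfl).trans h⟩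

/-- The lower bound makes preimages of a Cauchy sequence Cauchy. The conclusion places `(g, y)` in
the graph of the closure of `S - z`, stated through sequences. -/
theorem exists_tendsto_of_mem_closure_range {S : H →ₗ.[ℂ] H} {z : ℂ} {c : ℝ} (hc0 : 0 < c)
    (hc : ∀ f : S.domain, c * ‖(f : H)‖ ≤ ‖S f - z • (f : H)‖) {y : H}
    (hy : y ∈ _root_.closure (Set.range fun f : S.domain => S f - z • (f : H))) :
    ∃ (f : ℕ → S.domain) (g : H), Tendsto (fun k => (f k : H)) atTop (𝓝 g) ∧
      Tendsto (fun k => S (f k) - z • (f k : H)) atTop (𝓝 y) := by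
  obtain ⟨v, hv, hvy⟩ := mem_closure_iff_seq_limit.1 hy
  choose f hf using hv
  have hcauchy : CauchySeq fun k => (f k : H) := by
    rw [Metric.cauchySeq_iff]
    intro ε hε
    obtain ⟨N, hN⟩ := Metric.cauchySeq_iff.1 hvy.cauchySeq (c * ε) (by positivity)
    refine ⟨N, fun m hm n hn => ?_⟩
    have h1 := hN m hm n hn
    have h2 := hc (f m - f n)
    rw [dist_eq_norm] at h1 ⊢
    have h3 : S (f m - f n) - z • ((f m - f n : S.domain) : H) = v m - v n := by
      rw [← hf m, ← hf n, LinearPMap.map_sub, Submodule.coe_sub]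
      module
    rw [h3] at h2
    exact lt_of_mul_lt_mul_left (h2.trans_lt h1) hc0.le
  obtain ⟨g, hg⟩ := cauchySeq_tendsto_of_complete hcauchy
  exact ⟨f, g, hg, by simpa only [hf] using hvy⟩

/-- Every vector in the domain of the extension is the sum of a vector in the domain of the closure
of `S` and a vector in `ker (S* - t)`. -/
theorem exists_tendsto_extensionAt {S : H →ₗ.[ℂ] H} (hS : Dense (S.domain : Set H))
    (hsymm : S.IsFormalAdjoint S) {t c : ℝ} (hc0 : 0 < c)
    (hc : ∀ f : S.domain, c * ‖(f : H)‖ ≤ ‖S f - (t : ℂ) • (f : H)‖)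
    (x : (S.extensionAt t).domain) :
    ∃ (f : ℕ → S.domain) (g : H), Tendsto (fun k => (f k : H)) atTop (𝓝 g) ∧
      Tendsto (fun k => S (f k) - (t : ℂ) • (f k : H)) atTop
        (𝓝 (S.extensionAt t x - (t : ℂ) • (x : H))) ∧
      (x : H) - g ∈ S.adjoint.eigenspace t := by
  have hx := extensionAt_apply_sub_mem x
  rw [adjoint_eigenspace_ofReal hS, Submodule.orthogonal_orthogonal_eq_closure] at hx
  obtain ⟨f, g, hg, hy⟩ := exists_tendsto_of_mem_closure_range hc0 hc hx
  refine ⟨f, g, hg, hy, (mem_adjoint_eigenspace_iff hS).2 fun φ => ?_⟩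
  rw [Complex.conj_ofReal, inner_sub_left, sub_eq_zero]
  have hsymm_t (f : S.domain) : inner ℂ (f : H) (S φ - (t : ℂ) • (φ : H)) =
      inner ℂ (S f - (t : ℂ) • (f : H)) (φ : H) := by
    rw [inner_sub_left, inner_sub_right, hsymm f φ, inner_smul_left, inner_smul_right,
      Complex.conj_ofReal]
  have h1 : Tendsto (fun k => inner ℂ (f k : H) (S φ - (t : ℂ) • (φ : H))) atTop
      (𝓝 (inner ℂ g (S φ - (t : ℂ) • (φ : H)))) := hg.inner tendsto_const_nhds
  simp only [hsymm_t] at h1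
  have h2 := tendsto_nhds_unique h1 (hy.inner tendsto_const_nhds)
  rw [h2]
  obtain ⟨hx', -⟩ := mem_extensionAt_domain_iff.1 x.2
  rw [(extensionAt_le_adjoint S t).2 (y := ⟨x, hx'⟩) rfl, inner_sub_left, inner_sub_right,
    adjoint_isFormalAdjoint hS ⟨x, hx'⟩ φ, inner_smul_left, inner_smul_right, Complex.conj_ofReal]

/-- Write `y = g + u` with `u ∈ ker (S* - t)`. The domain condition on `x` kills the pairing of `(S*
- t) x` with `u`, and the pairing with `g` is a limit of pairings with vectors of `D(S)`. -/
theorem isFormalAdjoint_extensionAt {S : H →ₗ.[ℂ] H} (hS : Dense (S.domain : Set H))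
    (hsymm : S.IsFormalAdjoint S) {t c : ℝ} (hc0 : 0 < c)
    (hc : ∀ f : S.domain, c * ‖(f : H)‖ ≤ ‖S f - (t : ℂ) • (f : H)‖) :
    (S.extensionAt t).IsFormalAdjoint (S.extensionAt t) := by
  intro x y
  suffices h : inner ℂ (S.extensionAt t x - (t : ℂ) • (x : H)) (y : H) =
      inner ℂ (x : H) (S.extensionAt t y - (t : ℂ) • (y : H)) by
    rw [inner_sub_left, inner_sub_right, inner_smul_left, inner_smul_right,
      Complex.conj_ofReal] at h
    exact sub_left_injective h
  obtain ⟨f, g, hg, hy, hyg⟩ := exists_tendsto_extensionAt hS hsymm hc0 hc y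
  have h0 := Submodule.inner_left_of_mem_orthogonal hyg (extensionAt_apply_sub_mem x)
  rw [inner_sub_right, sub_eq_zero] at h0
  rw [h0]
  obtain ⟨hx, -⟩ := mem_extensionAt_domain_iff.1 x.2
  have h1 (k : ℕ) : inner ℂ (S.extensionAt t x - (t : ℂ) • (x : H)) (f k : H) =
      inner ℂ (x : H) (S (f k) - (t : ℂ) • (f k : H)) := by
    rw [(extensionAt_le_adjoint S t).2 (y := ⟨x, hx⟩) rfl, inner_sub_left, inner_sub_right,
      adjoint_isFormalAdjoint hS ⟨x, hx⟩ (f k), inner_smul_left, inner_smul_right,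
      Complex.conj_ofReal]
  refine tendsto_nhds_unique (tendsto_const_nhds.inner hg) ?_
  simp only [h1]
  exact tendsto_const_nhds.inner hy

/-- The extension contains `ker (S* - t)` as its own eigenspace. Testing a vector of the adjoint's
domain against that eigenspace yields exactly the defining orthogonality condition. -/
theorem isSelfAdjointExtension_extensionAt {S : H →ₗ.[ℂ] H} (hS : Dense (S.domain : Set H))
    (hsymm : S.IsFormalAdjoint S) {t c : ℝ} (hc0 : 0 < c)
    (hc : ∀ f : S.domain, c * ‖(f : H)‖ ≤ ‖S f - (t : ℂ) • (f : H)‖) :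
    S.IsSelfAdjointExtension (S.extensionAt t) := by
  have hle := le_extensionAt hS hsymm t
  refine ⟨hle, isSelfAdjoint_def.2 (le_antisymm ?_ ?_)⟩
  · have hle' := adjoint_le_adjoint hS hle
    have hA : Dense ((S.extensionAt t).domain : Set H) := hS.mono hle.1
    have hdom : (S.extensionAt t).adjoint.domain ≤ (S.extensionAt t).domain := by
      intro x hx
      refine mem_extensionAt_domain_iff.2 ⟨hle'.1 hx, ?_⟩
      rw [← hle'.2 (x := ⟨x, hx⟩) rfl, Submodule.mem_orthogonal']
      intro u hu
      rw [← eigenspace_extensionAt] at hu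
      obtain ⟨hu, h⟩ := mem_eigenspace_iff.1 hu
      rw [inner_sub_left, adjoint_isFormalAdjoint hA ⟨x, hx⟩ ⟨u, hu⟩, h, inner_smul_left,
        inner_smul_right, Complex.conj_ofReal, sub_self]
    refine ⟨hdom, fun x y hxy => ?_⟩
    have hy : (y : H) ∈ S.adjoint.domain := (extensionAt_le_adjoint S t).1 y.2
    rw [hle'.2 (y := ⟨y, hy⟩) hxy, (extensionAt_le_adjoint S t).2 (y := ⟨y, hy⟩) rfl]
  · exact (isFormalAdjoint_extensionAt hS hsymm hc0 hc).le_adjoint (hS.mono hle.1)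

/-- In a gap of `S` the extension has no eigenvalue other than `t`. -/
theorem eigenspace_extensionAt_eq_bot {S : H →ₗ.[ℂ] H} (hS : Dense (S.domain : Set H))
    (hsymm : S.IsFormalAdjoint S) {a b : EReal} (hgap : S.HasGap a b) {s t : ℝ}
    (hs : s ∈ openInterval a b) (ht : t ∈ openInterval a b) (hst : s ≠ t) :
    (S.extensionAt t).eigenspace s = ⊥ := by
  obtain ⟨c, hc0, hc⟩ := hgap.exists_pos_bound ht
  obtain ⟨m, r, hsm, htm, hr⟩ := hgap.exists_bound hs ht
  rw [eq_bot_iff]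
  intro h hh
  obtain ⟨hd, hA⟩ := mem_eigenspace_iff.1 hh
  have hperp := extensionAt_apply_sub_mem (S := S) (t := t) ⟨h, hd⟩
  obtain ⟨f, g, hg, hy, hu⟩ := exists_tendsto_extensionAt hS hsymm hc0 hc ⟨h, hd⟩
  rw [hA] at hperp hy
  simp only [← sub_smul] at hperp hy hu
  set u := h - g with hu_def
  have hst' : (s : ℂ) - t ≠ 0 := sub_ne_zero.2 (by exact_mod_cast hst)
  -- The vector `(s - t) • h` is orthogonal to `ker (S* - t)`, and `s ≠ t`.
  have horth : inner ℂ h u = 0 := by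
    have := Submodule.inner_left_of_mem_orthogonal hu hperp
    rw [inner_smul_left] at this
    exact (mul_eq_zero.1 this).resolve_left ((map_ne_zero _).2 hst')
  have hlim : Tendsto (fun k => S (f k) - (m : ℂ) • (f k : H)) atTop
      (𝓝 (((s : ℂ) - t) • h + ((t : ℂ) - m) • g)) := by
    refine (hy.add (hg.const_smul ((t : ℂ) - m))).congr fun k => ?_
    module
  have hle : r * ‖g‖ ≤ ‖((s : ℂ) - t) • h + ((t : ℂ) - m) • g‖ :=
    le_of_tendsto_of_tendsto' (hg.norm.const_mul r) hlim.norm fun k => hr (f k)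
  have hg_eq : g = h - u := by rw [hu_def]; abel
  have h1 : ((s : ℂ) - t) • h + ((t : ℂ) - m) • g =
      ((s - m : ℝ) : ℂ) • h - ((t - m : ℝ) : ℂ) • u := by
    rw [hg_eq]; push_cast; module
  have h2 : ‖g‖ ^ 2 = ‖h‖ ^ 2 + ‖u‖ ^ 2 := by
    rw [hg_eq, norm_sub_sq (𝕜 := ℂ), horth]
    simp
  have h3 : ‖((s : ℂ) - t) • h + ((t : ℂ) - m) • g‖ ^ 2 =
      (s - m) ^ 2 * ‖h‖ ^ 2 + (t - m) ^ 2 * ‖u‖ ^ 2 := by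
    rw [h1, norm_sub_sq (𝕜 := ℂ), inner_smul_left, inner_smul_right, horth, norm_smul, norm_smul,
      Complex.norm_real, Complex.norm_real, Real.norm_eq_abs, Real.norm_eq_abs, mul_pow, mul_pow,
      sq_abs, sq_abs]
    simp
  -- The gap estimate now reads `r² (‖h‖² + ‖u‖²) ≤ (s - m)² ‖h‖² + (t - m)² ‖u‖²`; as `s` and `t`
  -- are strictly within `r` of `m`, this forces `h = 0`.
  have hr0 : 0 < r := (abs_nonneg _).trans_lt hsm
  have h4 := pow_le_pow_left₀ (by positivity) hle 2
  rw [mul_pow, h2, h3] at h4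
  have h5 : (s - m) ^ 2 < r ^ 2 := sq_lt_sq.2 (by rwa [abs_of_pos hr0])
  have h6 : (t - m) ^ 2 < r ^ 2 := sq_lt_sq.2 (by rwa [abs_of_pos hr0])
  rw [Submodule.mem_bot, ← norm_eq_zero]
  by_contra hne
  have h7 : 0 < ‖h‖ ^ 2 := by positivity
  nlinarith [mul_pos h7 (sub_pos.2 h5), mul_nonneg (sq_nonneg ‖u‖) (sub_pos.2 h6).le]

/-- A symmetric operator with deficiency index `1` has, for each point `t` of a gap, a self-adjoint
extension with `t` as its only eigenvalue in the gap, of multiplicity `1`. -/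
theorem exists_isSelfAdjointExtension_eigenspace {S : H →ₗ.[ℂ] H}
    (hS : Dense (S.domain : Set H)) (hsymm : S.IsFormalAdjoint S) (hdef : S.HasDeficiencyIndex 1)
    {a b : EReal} (hgap : S.HasGap a b) {t : ℝ} (ht : t ∈ openInterval a b) :
    ∃ A : H →ₗ.[ℂ] H, S.IsSelfAdjointExtension A ∧
      (∃ u : H, ‖u‖ = 1 ∧ A.eigenspace t = Submodule.span ℂ {u}) ∧
      ∀ s ∈ openInterval a b, s ≠ t → A.eigenspace s = ⊥ := by
  obtain ⟨c, hc0, hc⟩ := hgap.exists_pos_bound ht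
  refine ⟨S.extensionAt t, isSelfAdjointExtension_extensionAt hS hsymm hc0 hc, ?_,
    fun s hs hst => eigenspace_extensionAt_eq_bot hS hsymm hgap hs ht hst⟩
  have h1 := hdef.deficiency_ofReal hS hsymm hc0 hc
  rw [deficiency, Cardinal.toENat_eq_one, rank_eq_one_iff] at h1
  obtain ⟨⟨v, hv⟩, hv0, hspan⟩ := h1
  have hv0' : v ≠ 0 := fun h => hv0 (Subtype.ext h)
  have hn : ((‖v‖ : ℂ))⁻¹ ≠ 0 := inv_ne_zero (by simpa using hv0')
  refine ⟨(‖v‖ : ℂ)⁻¹ • v, norm_smul_inv_norm hv0', ?_⟩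
  rw [Submodule.span_singleton_smul_eq hn.isUnit, eigenspace_extensionAt]
  refine le_antisymm (fun x hx => ?_) (by simpa using hv)
  obtain ⟨k, hk⟩ := hspan ⟨x, hx⟩
  exact Submodule.mem_span_singleton.2 ⟨k, congrArg Subtype.val hk⟩

end Single

/-! ### Orthogonal sums and their adjoints -/

section Sum

theorem _root_.lp.hasSum_norm_sq {ι : Type*} {H : ι → Type*} [∀ n, NormedAddCommGroup (H n)]
    (x : lp H 2) : HasSum (fun n => ‖x n‖ ^ 2) (‖x‖ ^ 2) := by
  have h := lp.hasSum_norm (p := 2) (by norm_num) x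
  simpa using h

variable {ι : Type*} {H : ι → Type*} [∀ n, NormedAddCommGroup (H n)]
  [∀ n, InnerProductSpace ℂ (H n)]

theorem orthogonalSum_apply {S : ∀ n, H n →ₗ.[ℂ] H n} (x : (orthogonalSum S).domain) (n : ι)
    (h : (x : lp H 2) n ∈ (S n).domain) : orthogonalSum S x n = S n ⟨(x : lp H 2) n, h⟩ :=
  rfl

theorem orthogonalSum_domain_apply_mem {S : ∀ n, H n →ₗ.[ℂ] H n} (x : (orthogonalSum S).domain)
    (n : ι) : (x : lp H 2) n ∈ (S n).domain :=
  x.2.choose n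

theorem orthogonalSum_mono {S A : ∀ n, H n →ₗ.[ℂ] H n} (h : ∀ n, S n ≤ A n) :
    orthogonalSum S ≤ orthogonalSum A := by
  have hdom : (orthogonalSum S).domain ≤ (orthogonalSum A).domain := by
    rintro x ⟨hx, hx2⟩
    refine ⟨fun n => (h n).1 (hx n), ?_⟩
    convert hx2 using 2 with n
    exact ((h n).2 rfl).symm
  refine ⟨hdom, fun x y hxy => lp.ext (funext fun n => ?_)⟩
  rw [orthogonalSum_apply x n (orthogonalSum_domain_apply_mem x n),
    orthogonalSum_apply y n (orthogonalSum_domain_apply_mem y n)]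
  exact (h n).2 (congrArg (fun w : lp H 2 => w n) hxy)

theorem apply_mem_eigenspace_of_mem_orthogonalSum {S : ∀ n, H n →ₗ.[ℂ] H n} {z : ℂ} {x : lp H 2}
    (hx : x ∈ (orthogonalSum S).eigenspace z) (n : ι) : x n ∈ (S n).eigenspace z := by
  obtain ⟨hd, h⟩ := mem_eigenspace_iff.1 hx
  have hn := orthogonalSum_domain_apply_mem ⟨x, hd⟩ n
  refine mem_eigenspace_iff.2 ⟨hn, ?_⟩
  rw [← orthogonalSum_apply ⟨x, hd⟩ n hn, h]
  rfl

theorem isFormalAdjoint_orthogonalSum {S T : ∀ n, H n →ₗ.[ℂ] H n}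
    (h : ∀ n, (S n).IsFormalAdjoint (T n)) :
    (orthogonalSum S).IsFormalAdjoint (orthogonalSum T) := by
  intro x y
  rw [lp.inner_eq_tsum, lp.inner_eq_tsum]
  exact tsum_congr fun n => h n ⟨_, orthogonalSum_domain_apply_mem x n⟩
    ⟨_, orthogonalSum_domain_apply_mem y n⟩

/-- The component of a vector in the domain of an orthogonal sum. -/
def domainComponent {S : ∀ n, H n →ₗ.[ℂ] H n} (x : (orthogonalSum S).domain) (n : ι) :
    (S n).domain :=
  ⟨(x : lp H 2) n, orthogonalSum_domain_apply_mem x n⟩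

theorem hasSum_norm_sq_domainComponent {S : ∀ n, H n →ₗ.[ℂ] H n} (x : (orthogonalSum S).domain) :
    HasSum (fun n => ‖(domainComponent x n : H n)‖ ^ 2) (‖(x : lp H 2)‖ ^ 2) :=
  lp.hasSum_norm_sq (x : lp H 2)

theorem hasSum_norm_sq_orthogonalSum_sub {S : ∀ n, H n →ₗ.[ℂ] H n}
    (x : (orthogonalSum S).domain) (z : ℂ) :
    HasSum (fun n => ‖S n (domainComponent x n) - z • (domainComponent x n : H n)‖ ^ 2)
      (‖orthogonalSum S x - z • (x : lp H 2)‖ ^ 2) :=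
  lp.hasSum_norm_sq (orthogonalSum S x - z • (x : lp H 2))

theorem hasSum_re_inner_orthogonalSum {S : ∀ n, H n →ₗ.[ℂ] H n} (x : (orthogonalSum S).domain) :
    HasSum (fun n => (inner ℂ (domainComponent x n : H n) (S n (domainComponent x n))).re)
      (inner ℂ (x : lp H 2) (orthogonalSum S x)).re :=
  Complex.hasSum_re (lp.hasSum_inner (x : lp H 2) (orthogonalSum S x))

theorem hasGap_orthogonalSum [Nonempty ι] {S : ∀ n, H n →ₗ.[ℂ] H n} {a b : EReal}
    (h : ∀ n, (S n).HasGap a b) : (orthogonalSum S).HasGap a b := by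
  -- A single summand already decides which of the three forms `(a, b)` takes; the matching
  -- inequalities are then summed over the components.
  rcases h (Classical.arbitrary ι) with
    ⟨β, rfl, rfl, -⟩ | ⟨α, β, rfl, rfl, hαβ, -⟩ | ⟨α, rfl, rfl, -⟩
  · refine hasGap_bot_coe_iff.2 fun x => ?_
    exact hasSum_le (fun n => hasGap_bot_coe_iff.1 (h n) (domainComponent x n))
      ((hasSum_norm_sq_domainComponent x).mul_left β) (hasSum_re_inner_orthogonalSum x)
  · refine hasGap_coe_coe_iff.2 ⟨hαβ, fun x => ?_⟩
    have h0 : 0 ≤ (β - α) / 2 := by linarith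
    refine le_of_sq_le_sq ?_ (norm_nonneg _)
    rw [mul_pow]
    refine hasSum_le (fun n => ?_)
      ((hasSum_norm_sq_domainComponent x).mul_left (((β - α) / 2) ^ 2))
      (hasSum_norm_sq_orthogonalSum_sub x _)
    rw [← mul_pow]
    exact pow_le_pow_left₀ (by positivity)
      ((hasGap_coe_coe_iff.1 (h n)).2 (domainComponent x n)) 2
  · refine hasGap_coe_top_iff.2 fun x => ?_
    exact hasSum_le (fun n => hasGap_coe_top_iff.1 (h n) (domainComponent x n))
      (hasSum_re_inner_orthogonalSum x) ((hasSum_norm_sq_domainComponent x).mul_left α)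

variable [DecidableEq ι]

theorem _root_.lp.inner_single_single_of_ne {m n : ι} (hmn : m ≠ n) (x : H m) (y : H n) :
    inner ℂ (lp.single (E := H) 2 m x) (lp.single 2 n y) = 0 := by
  rw [lp.inner_single_left, lp.single_apply_ne _ _ _ hmn, inner_zero_right]

/-- Vectors supported in one coordinate are the test vectors that reduce density, adjoints and
eigenspaces of the sum to the summands. -/
theorem exists_orthogonalSum_single {S : ∀ n, H n →ₗ.[ℂ] H n} {n : ι} (x : (S n).domain) :
    ∃ h : lp.single 2 n (x : H n) ∈ (orthogonalSum S).domain,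
      orthogonalSum S ⟨lp.single 2 n (x : H n), h⟩ = lp.single 2 n (S n x) := by
  have hmem (m : ι) : lp.single (E := H) 2 n (x : H n) m ∈ (S m).domain := by
    rcases eq_or_ne m n with rfl | hm
    · rw [lp.single_apply_self]
      exact x.2
    · rw [lp.single_apply_ne _ _ _ hm]
      exact Submodule.zero_mem _
  have happly (m : ι) : S m ⟨lp.single (E := H) 2 n (x : H n) m, hmem m⟩ =
      lp.single (E := H) 2 n (S n x) m := by
    rcases eq_or_ne m n with rfl | hm
    · have h0 : (⟨_, hmem m⟩ : (S m).domain) = x :=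
        Subtype.ext (lp.single_apply_self 2 m (x : H m))
      exact (congrArg (S m) h0).trans (lp.single_apply_self 2 m (S m x)).symm
    · have h0 : (⟨_, hmem m⟩ : (S m).domain) = 0 :=
        Subtype.ext (lp.single_apply_ne 2 n (x : H n) hm)
      exact (congrArg (S m) h0).trans
        ((S m).map_zero.trans (lp.single_apply_ne 2 n (S n x) hm).symm)
  have h : lp.single 2 n (x : H n) ∈ (orthogonalSum S).domain := by
    refine ⟨hmem, ?_⟩
    simp only [happly]
    exact lp.memℓp _
  exact ⟨h, lp.ext (funext happly)⟩

theorem single_mem_eigenspace_orthogonalSum {S : ∀ n, H n →ₗ.[ℂ] H n} {z : ℂ} {n : ι} {x : H n}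
    (hx : x ∈ (S n).eigenspace z) : lp.single 2 n x ∈ (orthogonalSum S).eigenspace z := by
  obtain ⟨hd, h⟩ := mem_eigenspace_iff.1 hx
  obtain ⟨hd', h'⟩ := exists_orthogonalSum_single ⟨x, hd⟩
  refine mem_eigenspace_iff.2 ⟨hd', ?_⟩
  rw [h', h, lp.single_smul]

variable [∀ n, CompleteSpace (H n)]

theorem dense_orthogonalSum_domain {S : ∀ n, H n →ₗ.[ℂ] H n}
    (hS : ∀ n, Dense ((S n).domain : Set (H n))) :
    Dense ((orthogonalSum S).domain : Set (lp H 2)) := by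
  rw [Submodule.dense_iff_topologicalClosure_eq_top, Submodule.topologicalClosure_eq_top_iff,
    eq_bot_iff]
  intro y hy
  rw [Submodule.mem_bot]
  refine lp.ext (funext fun n => ?_)
  refine (hS n).eq_zero_of_inner_right ℂ fun x hx => ?_
  rw [← lp.inner_single_left n x y]
  exact (Submodule.mem_orthogonal _ _).1 hy _ (exists_orthogonalSum_single ⟨x, hx⟩).1

/-- The adjoint of an orthogonal sum is the orthogonal sum of the adjoints. -/
theorem adjoint_orthogonalSum {S : ∀ n, H n →ₗ.[ℂ] H n}
    (hS : ∀ n, Dense ((S n).domain : Set (H n))) :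
    (orthogonalSum S).adjoint = orthogonalSum fun n => (S n).adjoint := by
  have hd := dense_orthogonalSum_domain hS
  refine le_antisymm ?_ (IsFormalAdjoint.le_adjoint hd
    (isFormalAdjoint_orthogonalSum fun n => (adjoint_isFormalAdjoint (hS n)).symm))
  have key (y : (orthogonalSum S).adjoint.domain) (n : ι) (x : (S n).domain) :
      inner ℂ ((orthogonalSum S).adjoint y n) (x : H n) = inner ℂ ((y : lp H 2) n) (S n x) := by
    obtain ⟨h, h'⟩ := exists_orthogonalSum_single x
    rw [← lp.inner_single_right, ← lp.inner_single_right, ← h']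
    exact adjoint_isFormalAdjoint hd y ⟨_, h⟩
  have hmem (y : (orthogonalSum S).adjoint.domain) (n : ι) :
      (y : lp H 2) n ∈ (S n).adjoint.domain :=
    mem_adjoint_domain_of_exists _ ⟨_, key y n⟩
  have happly (y : (orthogonalSum S).adjoint.domain) (n : ι) :
      (S n).adjoint ⟨(y : lp H 2) n, hmem y n⟩ = (orthogonalSum S).adjoint y n :=
    adjoint_apply_eq (hS n) _ (key y n)
  -- Square summability comes for free: the images of the components are the coordinates of a vector
  -- of the Hilbert sum.
  refine ⟨fun y hy => ⟨hmem ⟨y, hy⟩, ?_⟩, ?_⟩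
  · simp only [happly ⟨y, hy⟩]
    exact lp.memℓp _
  · rintro y ⟨_, hx⟩ rfl
    exact lp.ext (funext fun n => (happly y n).symm)

theorem isSelfAdjoint_orthogonalSum {A : ∀ n, H n →ₗ.[ℂ] H n} (hA : ∀ n, IsSelfAdjoint (A n)) :
    IsSelfAdjoint (orthogonalSum A) := by
  rw [isSelfAdjoint_def, adjoint_orthogonalSum fun n => (hA n).dense_domain]
  congr 1
  exact funext fun n => isSelfAdjoint_def.1 (hA n)

theorem isSelfAdjointExtension_orthogonalSum {S A : ∀ n, H n →ₗ.[ℂ] H n}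
    (h : ∀ n, (S n).IsSelfAdjointExtension (A n)) :
    (orthogonalSum S).IsSelfAdjointExtension (orthogonalSum A) :=
  ⟨orthogonalSum_mono fun n => (h n).1, isSelfAdjoint_orthogonalSum fun n => (h n).2⟩

/-! ### Deficiency, multiplicities and essential spectrum of the sum -/

theorem deficiency_orthogonalSum_eq_top [Infinite ι] {S : ∀ n, H n →ₗ.[ℂ] H n}
    (hS : ∀ n, Dense ((S n).domain : Set (H n))) {z : ℂ} (h : ∀ n, (S n).deficiency z ≠ 0) :
    (orthogonalSum S).deficiency z = ⊤ := by
  have hne (n : ι) : ∃ u ∈ (S n).adjoint.eigenspace z, u ≠ 0 := by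
    refine Submodule.exists_mem_ne_zero_of_ne_bot fun h0 => h n ?_
    simp [deficiency, h0]
  choose u hu hu0 using hne
  rw [deficiency, adjoint_orthogonalSum hS, Cardinal.toENat_eq_top]
  have hlin : LinearIndependent ℂ fun n => (⟨lp.single 2 n (u n),
      single_mem_eigenspace_orthogonalSum (hu n)⟩ :
        (orthogonalSum fun n => (S n).adjoint).eigenspace z) := by
    refine linearIndependent_of_ne_zero_of_inner_eq_zero (𝕜 := ℂ) (fun n h0 => hu0 n ?_)
      fun m n hmn => lp.inner_single_single_of_ne hmn _ _
    have h1 : lp.single (E := H) 2 n (u n) = 0 := congrArg Subtype.val h0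
    rw [← norm_eq_zero, ← lp.norm_single (E := H) (p := 2) (by norm_num) n (u n), h1, norm_zero]
  exact hlin.aleph0_le_rank

/-- If the eigenspaces of the summands at `z` are spanned by a unit vector for the indices in the range
of an injection `e` and trivial for the others, then the multiplicity of `z` is the size of the
domain of `e`. -/
theorem hasMultiplicity_orthogonalSum {A : ∀ n, H n →ₗ.[ℂ] H n} (hA : ∀ n, IsSelfAdjoint (A n))
    {z : ℂ} {κ : Type*} {e : κ → ι} (he : Function.Injective e) {u : ∀ n, H n}
    (hu : ∀ n, ‖u n‖ = 1) (hspan : ∀ j, (A (e j)).eigenspace z = Submodule.span ℂ {u (e j)})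
    (hbot : ∀ n ∉ Set.range e, (A n).eigenspace z = ⊥) :
    (orthogonalSum A).HasMultiplicity z κ := by
  have : CompleteSpace ((orthogonalSum A).eigenspace z) :=
    ((isSelfAdjoint_orthogonalSum hA).isClosed_eigenspace z).completeSpace_coe
  have hmem (j : κ) : u (e j) ∈ (A (e j)).eigenspace z := by
    rw [hspan]
    exact Submodule.mem_span_singleton_self _
  let v (j : κ) : (orthogonalSum A).eigenspace z :=
    ⟨lp.single 2 (e j) (u (e j)), single_mem_eigenspace_orthogonalSum (hmem j)⟩
  have hv : Orthonormal ℂ v := by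
    refine ⟨fun j => ?_, fun i j hij => lp.inner_single_single_of_ne (he.ne hij) _ _⟩
    exact (lp.norm_single (by norm_num) _ _).trans (hu _)
  refine ⟨HilbertBasis.mkOfOrthogonalEqBot hv ?_⟩
  rw [eq_bot_iff]
  rintro ⟨x, hx⟩ hperp
  rw [Submodule.mem_bot]
  refine Subtype.ext (lp.ext (funext fun n => ?_))
  have hxn := apply_mem_eigenspace_of_mem_orthogonalSum hx n
  by_cases hn : n ∈ Set.range e
  · obtain ⟨j, rfl⟩ := hn
    have h0 : inner ℂ (v j) ⟨x, hx⟩ = 0 :=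
      (Submodule.mem_orthogonal _ _).1 hperp _ (Submodule.subset_span ⟨j, rfl⟩)
    have h1 : inner ℂ (u (e j)) (x (e j)) = 0 := (lp.inner_single_left _ _ _).symm.trans h0
    -- The component is a multiple of the unit vector `u (e j)` and orthogonal to it, hence zero.
    rw [hspan, Submodule.mem_span_singleton] at hxn
    obtain ⟨k, hk⟩ := hxn
    rw [← hk, inner_smul_right, inner_self_eq_norm_sq_to_K, hu] at h1
    have hk0 : k = 0 := by simpa using h1
    rw [← hk, hk0, zero_smul]
    rfl
  · rw [hbot n hn] at hxn
    exact hxn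

/-- A countable family of points of a common gap is realised, with multiplicities, as eigenvalues of
a self-adjoint extension of the orthogonal sum. -/
theorem exists_isSelfAdjointExtension_orthogonalSum [Infinite ι] {S : ∀ n, H n →ₗ.[ℂ] H n}
    (hS : ∀ n, Dense ((S n).domain : Set (H n))) (hsymm : ∀ n, (S n).IsFormalAdjoint (S n))
    (hdef : ∀ n, (S n).HasDeficiencyIndex 1) {a b : EReal} (hab : a < b)
    (hgap : ∀ n, (S n).HasGap a b) {κ : Type*} [Countable κ] {lam : κ → ℝ}
    (hlam : ∀ k, lam k ∈ openInterval a b) :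
    ∃ A : lp H 2 →ₗ.[ℂ] lp H 2, (orthogonalSum S).IsSelfAdjointExtension A ∧
      ∀ k, A.HasEigenvalue (lam k : ℂ) ∧ A.HasMultiplicity (lam k : ℂ) {j : κ // lam j = lam k} := by
  have hne : (openInterval a b).Nonempty := EReal.lt_iff_exists_real_btwn.1 hab
  -- The family is countable, so the open gap contains a point `μ` outside it. Surplus summands
  -- receive `μ` and add nothing to any prescribed multiplicity.
  obtain ⟨μ, hμ, hμ'⟩ :=
    ((Set.countable_range lam).dense_compl ℝ).inter_open_nonempty _ isOpen_openInterval hne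
  obtain ⟨e₀, he₀⟩ := exists_injective_nat κ
  obtain ⟨e₁⟩ : Nonempty (ℕ ↪ ι) := ⟨Infinite.natEmbedding ι⟩
  set e : κ → ι := e₁ ∘ e₀ with he_def
  have he : Function.Injective e := e₁.injective.comp he₀
  set τ : ι → ℝ := Function.extend e lam fun _ => μ with hτ_def
  have hτe (k : κ) : τ (e k) = lam k := he.extend_apply _ _ _
  have hτμ (n : ι) (hn : n ∉ Set.range e) : τ n = μ := Function.extend_apply' _ _ _ hn
  have hτ (n : ι) : τ n ∈ openInterval a b := by
    by_cases hn : n ∈ Set.range e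
    · obtain ⟨k, rfl⟩ := hn
      rw [hτe]
      exact hlam k
    · rw [hτμ n hn]
      exact hμ
  choose A hext hspan hbot using fun n =>
    exists_isSelfAdjointExtension_eigenspace (hS n) (hsymm n) (hdef n) (hgap n) (hτ n)
  choose u hu hspan using hspan
  refine ⟨orthogonalSum A, isSelfAdjointExtension_orthogonalSum hext, fun k => ⟨fun h0 => ?_, ?_⟩⟩
  · have h1 : u (e k) ∈ (A (e k)).eigenspace (lam k : ℂ) := by
      rw [← hτe, hspan]
      exact Submodule.mem_span_singleton_self _
    have h2 := single_mem_eigenspace_orthogonalSum h1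
    rw [h0, Submodule.mem_bot] at h2
    have h3 := lp.norm_single (E := H) (p := 2) (by norm_num) (e k) (u (e k))
    rw [h2, norm_zero, hu] at h3
    exact zero_ne_one h3
  · refine hasMultiplicity_orthogonalSum (fun n => (hext n).2)
      (e := fun j : {j : κ // lam j = lam k} => e j) (he.comp Subtype.val_injective) hu
      (fun j => ?_) fun n hn => ?_
    · rw [← hspan, hτe, j.2]
    · refine hbot n _ (hlam k) fun h => ?_
      by_cases hn' : n ∈ Set.range e
      · obtain ⟨j, rfl⟩ := hn'
        exact hn ⟨⟨j, (hτe j).symm.trans h.symm⟩, rfl⟩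
      · exact hμ' ⟨k, h.trans (hτμ n hn')⟩

/-- Some self-adjoint extension of the orthogonal sum has the closure of a common gap in its
essential spectrum. -/
theorem exists_isSelfAdjointExtension_closure_subset_essentialSpectrum [Infinite ι]
    {S : ∀ n, H n →ₗ.[ℂ] H n}
    (hS : ∀ n, Dense ((S n).domain : Set (H n))) (hsymm : ∀ n, (S n).IsFormalAdjoint (S n))
    (hdef : ∀ n, (S n).HasDeficiencyIndex 1) {a b : EReal} (hab : a < b)
    (hgap : ∀ n, (S n).HasGap a b) :
    ∃ A : lp H 2 →ₗ.[ℂ] lp H 2, (orthogonalSum S).IsSelfAdjointExtension A ∧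
      ∀ t ∈ _root_.closure (openInterval a b), (t : ℂ) ∈ A.essentialSpectrum := by
  obtain ⟨A, hA, hlam⟩ := exists_isSelfAdjointExtension_orthogonalSum hS hsymm hdef hab hgap
    (κ := {q : ℚ // (q : ℝ) ∈ openInterval a b}) (lam := fun q => (q : ℚ)) (fun q => q.2)
  refine ⟨A, hA, fun t ht => mem_essentialSpectrum_of_frequently ?_⟩
  rw [frequently_nhdsWithin_iff, Metric.nhds_basis_ball.frequently_iff]
  intro ε hε
  have hne : (Metric.ball t ε ∩ openInterval a b).Nonempty :=
    mem_closure_iff.1 ht _ Metric.isOpen_ball (Metric.mem_ball_self hε)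
  -- Rationals other than `t` remain dense, so an eigenvalue different from `t` is found even when
  -- `t` is itself a rational of the gap.
  obtain ⟨_, ⟨hq1, hq2⟩, ⟨q, rfl⟩, hqt⟩ := (Rat.denseRange_cast (𝕜 := ℝ)).sdiff_singleton t
    |>.inter_open_nonempty _ (Metric.isOpen_ball.inter isOpen_openInterval) hne
  refine ⟨((q : ℝ) : ℂ), ?_, (hlam ⟨q, hq2⟩).1, fun h => hqt (Complex.ofReal_injective h)⟩
  rw [Metric.mem_ball, Complex.dist_eq, ← Complex.ofReal_sub, Complex.norm_real]
  exact hq1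

end Sum

end LinearPMap

theorem mainTheorem3
    {H : ℕ → Type*} [∀ n, NormedAddCommGroup (H n)] [∀ n, InnerProductSpace ℂ (H n)]
    [∀ n, CompleteSpace (H n)]
    (S : ∀ n, H n →ₗ.[ℂ] H n)
    (hdense : ∀ n, Dense ((S n).domain : Set (H n)))
    (hsymm : ∀ n, (S n).IsFormalAdjoint (S n))
    (hdef : ∀ n, (S n).HasDeficiencyIndex 1)
    (α β : ℕ → EReal) (hgap : ∀ n, (S n).HasGap (α n) (β n))
    (a b : EReal) (hab : a < b) (hα : ∀ n, α n ≤ a) (hβ : ∀ n, b ≤ β n) :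
    (Dense ((LinearPMap.orthogonalSum S).domain : Set (lp H 2)) ∧
      (LinearPMap.orthogonalSum S).IsFormalAdjoint (LinearPMap.orthogonalSum S) ∧
      (LinearPMap.orthogonalSum S).HasGap a b ∧
      (LinearPMap.orthogonalSum S).HasDeficiencyIndex ⊤ ∧
      (∀ t ∈ LinearPMap.openInterval a b,
        (LinearPMap.orthogonalSum S).deficiency (t : ℂ) = ⊤) ∧
      ∃ A : lp H 2 →ₗ.[ℂ] lp H 2, (LinearPMap.orthogonalSum S).IsSelfAdjointExtension A) ∧
    (∀ (ι : Type*) [Countable ι] (lam : ι → ℝ),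
      (∀ k, lam k ∈ LinearPMap.openInterval a b) →
      ∃ A : lp H 2 →ₗ.[ℂ] lp H 2, (LinearPMap.orthogonalSum S).IsSelfAdjointExtension A ∧
        ∀ k, A.HasEigenvalue (lam k : ℂ) ∧
          A.HasMultiplicity (lam k : ℂ) {j : ι // lam j = lam k}) ∧
    (∀ K : Set ℝ, IsClosed K → K ⊆ closure (LinearPMap.openInterval a b) →
      ∃ A : lp H 2 →ₗ.[ℂ] lp H 2, (LinearPMap.orthogonalSum S).IsSelfAdjointExtension A ∧
        ∀ t ∈ K, (t : ℂ) ∈ A.essentialSpectrum) := by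
  have hgap' (n : ℕ) : (S n).HasGap a b := (hgap n).mono hab (hα n) (hβ n)
  refine ⟨⟨LinearPMap.dense_orthogonalSum_domain hdense,
    LinearPMap.isFormalAdjoint_orthogonalSum hsymm, LinearPMap.hasGap_orthogonalSum hgap',
    fun z hz => ?_, fun t ht => ?_, ?_⟩, fun ι _ lam hlam => ?_, fun K _ hK => ?_⟩
  · exact LinearPMap.deficiency_orthogonalSum_eq_top hdense fun n => by simp [hdef n z hz]
  · refine LinearPMap.deficiency_orthogonalSum_eq_top hdense fun n => ?_
    obtain ⟨c, hc0, hc⟩ := (hgap' n).exists_pos_bound ht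
    simp [(hdef n).deficiency_ofReal (hdense n) (hsymm n) hc0 hc]
  · obtain ⟨A, hA, -⟩ :=
      LinearPMap.exists_isSelfAdjointExtension_closure_subset_essentialSpectrum hdense hsymm hdef
        hab hgap'
    exact ⟨A, hA⟩
  · exact LinearPMap.exists_isSelfAdjointExtension_orthogonalSum hdense hsymm hdef hab hgap' hlam
  · obtain ⟨A, hA, hess⟩ :=
      LinearPMap.exists_isSelfAdjointExtension_closure_subset_essentialSpectrum hdense hsymm hdef
        hab hgap'
    exact ⟨A, hA, fun t ht => hess t (hK ht)⟩
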